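/- Let $K$ be a field, $n\ge 0$, and $S=K[x_1,\dots,x_n]$ with its standard $\mathbb{Z}^n$-grading. For a nonzero monomial ideal $I\subseteq S$, a Stanley decomposition of $I$ is a finite direct sum decomposition $\mathcal{D}: I=\bigoplus_{i=1}^m u_iK[Z_i]$ as a $\mathbb{Z}^n$-graded $K$-vector space, where each $u_i\in I$ is a nonzero homogeneous element (a scalar multiple of a monomial) and each $Z_i$ is a subset of $\{x_1,\dots,x_n\}$. Put $\operatorname{sdepth}(\mathcal{D})=\min_i|Z_i|$, and let $\operatorname{sdepth}(I)$ be the maximum of $\operatorname{sdepth}(\mathcal{D})$ over all Stanley decompositions $\mathcal{D}$ of $I$. Let $I\subseteq S$ be a nonzero squarefree monomial ideal (an ideal generated by squarefree monomials) that can be generated by $4$ elements. Then the maximum defining $\operatorname{sdepth}(I)$ exists, and $$\operatorname{sdepth}(I)\ge n-2.$$ -/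

import Mathlib

noncomputable section

open MvPolynomial

namespace StanleyDepth

variable {K : Type*} [Field K] {n : ℕ}

/-- An ideal of `K[x_1, …, x_n]` is a squarefree monomial ideal if it is generated by
squarefree monomials, i.e. by monomials `x^c` with every exponent `c i` equal to `0` or `1`. -/
def IsSquarefreeMonomialIdeal (I : Ideal (MvPolynomial (Fin n) K)) : Prop :=
  ∃ A : Set (Fin n →₀ ℕ), (∀ c ∈ A, ∀ i, c i ≤ 1) ∧
    I = Ideal.span ((fun c => monomial c (1 : K)) '' A)

/-- Homogeneous elements for the `ℤ^n`-grading of `K[x_1, …, x_n]`: scalar multiples of a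
monomial. -/
def IsMultihomogeneous (u : MvPolynomial (Fin n) K) : Prop :=
  ∃ (c : Fin n →₀ ℕ) (a : K), u = monomial c a

/-- The `K`-subspace `u K[Z]` of `K[x_1, …, x_n]`, where `K[Z]` is the polynomial ring in the
variables `x_j`, `j ∈ Z`. -/
def stanleySpace (u : MvPolynomial (Fin n) K) (Z : Finset (Fin n)) :
    Submodule K (MvPolynomial (Fin n) K) :=
  (Subalgebra.toSubmodule (supported K (Z : Set (Fin n)))).map (LinearMap.mulLeft K u)

/-- A Stanley decomposition of the ideal `I`: finitely many nonzero homogeneous elements `u_i`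
of `I` and sets of variables `Z_i` such that `I` is the (internal) direct sum of the
`K`-subspaces `u_i K[Z_i]`. Each `u_i K[Z_i]` is spanned by monomials, so this is a
decomposition as `ℤ^n`-graded `K`-vector space. -/
structure StanleyDecomposition (I : Ideal (MvPolynomial (Fin n) K)) where
  /-- the number of summands -/
  len : ℕ
  /-- the elements `u_i` -/
  gen : Fin len → MvPolynomial (Fin n) K
  /-- the sets of variables `Z_i` -/
  vars : Fin len → Finset (Fin n)
  gen_mem : ∀ i, gen i ∈ I
  gen_ne_zero : ∀ i, gen i ≠ 0
  gen_homogeneous : ∀ i, IsMultihomogeneous (gen i)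
  independent : iSupIndep fun i => stanleySpace (gen i) (vars i)
  iSup_eq : ⨆ i, stanleySpace (gen i) (vars i) = Submodule.restrictScalars K I

/-- The Stanley depth `min |Z_i|` of a Stanley decomposition (of a nonzero ideal, so that there
is at least one summand). -/
def StanleyDecomposition.sdepth {I : Ideal (MvPolynomial (Fin n) K)}
    (D : StanleyDecomposition I) : ℕ :=
  ⨅ i, (D.vars i).card

/-- The set of Stanley depths of all Stanley decompositions of `I`. -/
def sdepthSet (I : Ideal (MvPolynomial (Fin n) K)) : Set ℕ :=
  Set.range (StanleyDecomposition.sdepth (I := I))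

/-- The Stanley depth of `I`: the maximum of the Stanley depths of its Stanley decompositions. -/
def sdepth (I : Ideal (MvPolynomial (Fin n) K)) : ℕ :=
  sSup (sdepthSet I)

end StanleyDepth

end

/-! The ideal is spanned by the monomials `x^c` with `c` in an upper set `M`, and comparing with the
four given generators shows that `M` is a union of four orthants `Set.Ici (v i)`
(`exists_iUnion_Ici`). Sort each `c` in `M` by the nonempty set `T c` of indices `i` with `v i ≤ c`.
Partition the nonempty subsets of `Fin 4` into intervals `[A, B]` with at least two elements in
every `B`. The `c` with `T c` in `[A, B]` are the multiples of the lcm of the `v i`, `i ∈ A`, minus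
the multiples of at most two `v i`, `i ∉ B`. Removing the multiples of one monomial costs at most
one free direction (`hasBoxPartition_box_diff_Ici`), so every piece splits into boxes with at least
`n - 2` free directions, and disjoint boxes give Stanley spaces in direct sum. -/

open MvPolynomial

namespace StanleyDepth

/-! ### Box partitions of sets of exponents -/

section Box

variable {σ : Type*}

/-- The exponents of the monomials in `x^u K[Z]`. -/
def box (u : σ →₀ ℕ) (Z : Finset σ) : Set (σ →₀ ℕ) :=
  {c | u ≤ c ∧ ∀ k ∉ Z, c k = u k}

/-- `M` is a finite disjoint union of boxes with at least `d` free directions each. -/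
def HasBoxPartition (d : ℕ) (M : Set (σ →₀ ℕ)) : Prop :=
  ∃ (ι : Type) (_ : Finite ι) (u : ι → σ →₀ ℕ) (Z : ι → Finset σ),
    (∀ i, d ≤ (Z i).card) ∧ Pairwise (fun i j => Disjoint (box (u i) (Z i)) (box (u j) (Z j))) ∧
      ⋃ i, box (u i) (Z i) = M

theorem self_mem_box (u : σ →₀ ℕ) (Z : Finset σ) : u ∈ box u Z :=
  ⟨le_rfl, fun _ _ => rfl⟩

theorem HasBoxPartition.mono {d e : ℕ} {M : Set (σ →₀ ℕ)} (hde : d ≤ e)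
    (h : HasBoxPartition e M) : HasBoxPartition d M := by
  obtain ⟨ι, hι, u, Z, h1, h2, h3⟩ := h
  exact ⟨ι, hι, u, Z, fun i => hde.trans (h1 i), h2, h3⟩

theorem hasBoxPartition_empty (d : ℕ) : HasBoxPartition d (∅ : Set (σ →₀ ℕ)) :=
  ⟨Empty, inferInstance, Empty.elim, Empty.elim, fun i => i.elim, fun i => i.elim, by simp⟩

theorem hasBoxPartition_box {d : ℕ} (u : σ →₀ ℕ) {Z : Finset σ} (h : d ≤ Z.card) :
    HasBoxPartition d (box u Z) :=
  ⟨Unit, inferInstance, fun _ => u, fun _ => Z, fun _ => h,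
    fun i j hij => (hij (Subsingleton.elim i j)).elim, Set.iUnion_const _⟩

theorem hasBoxPartition_iUnion {d : ℕ} {κ : Type} [Finite κ] {M : κ → Set (σ →₀ ℕ)}
    (hM : Pairwise (fun i j => Disjoint (M i) (M j))) (h : ∀ i, HasBoxPartition d (M i)) :
    HasBoxPartition d (⋃ i, M i) := by
  choose ι hι u Z h1 h2 h3 using h
  refine ⟨Σ i, ι i, inferInstance, fun x => u x.1 x.2, fun x => Z x.1 x.2,
    fun x => h1 _ _, ?_, ?_⟩
  · rintro ⟨i, a⟩ ⟨j, b⟩ hne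
    by_cases hij : i = j
    · subst hij
      exact h2 i fun hab => hne (congrArg (Sigma.mk i) hab)
    · refine (hM hij).mono ?_ ?_
      · rw [← h3 i]
        exact Set.subset_iUnion (fun a => box (u i a) (Z i a)) a
      · rw [← h3 j]
        exact Set.subset_iUnion (fun b => box (u j b) (Z j b)) b
  · rw [Set.iUnion_sigma]
    exact Set.iUnion_congr h3

theorem HasBoxPartition.union {d : ℕ} {M N : Set (σ →₀ ℕ)} (hMN : Disjoint M N)
    (hM : HasBoxPartition d M) (hN : HasBoxPartition d N) : HasBoxPartition d (M ∪ N) := by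
  rw [Set.union_eq_iUnion]
  refine hasBoxPartition_iUnion ?_ ?_
  · rintro (_ | _) (_ | _) h
    exacts [(h rfl).elim, hMN.symm, hMN, (h rfl).elim]
  · rintro (_ | _)
    exacts [hN, hM]

theorem mem_box_erase_iff [DecidableEq σ] {u c : σ →₀ ℕ} {Z : Finset σ} {k : σ} :
    c ∈ box u (Z.erase k) ↔ c ∈ box u Z ∧ c k = u k := by
  constructor
  · rintro ⟨h1, h2⟩
    exact ⟨⟨h1, fun l hl => h2 l fun h => hl (Finset.mem_of_mem_erase h)⟩, h2 k (by simp)⟩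
  · rintro ⟨⟨h1, h2⟩, h3⟩
    refine ⟨h1, fun l hl => ?_⟩
    by_cases hlk : l = k
    · rw [hlk, h3]
    · exact h2 l fun h => hl (Finset.mem_erase.2 ⟨hlk, h⟩)

theorem mem_box_add_single_iff {u c : σ →₀ ℕ} {Z : Finset σ} {k : σ} (hk : k ∈ Z) :
    c ∈ box (u + Finsupp.single k 1) Z ↔ c ∈ box u Z ∧ c k ≠ u k := by
  classical
  constructor
  · rintro ⟨h1, h2⟩
    refine ⟨⟨le_self_add.trans h1, fun l hl => ?_⟩, ?_⟩
    · have hkl : k ≠ l := fun h => hl (h ▸ hk)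
      simpa [Finsupp.single_apply, hkl] using h2 l hl
    · have := h1 k
      simp at this
      omega
  · rintro ⟨⟨h1, h2⟩, h3⟩
    refine ⟨fun l => ?_, fun l hl => ?_⟩
    · have := h1 l
      by_cases hkl : k = l
      · subst hkl
        simp
        omega
      · simpa [Finsupp.single_apply, hkl] using this
    · have hkl : k ≠ l := fun h => hl (h ▸ hk)
      simpa [Finsupp.single_apply, hkl] using h2 l hl

/-- Removing the multiples of one monomial from a box costs one free direction. -/
theorem hasBoxPartition_box_diff_Ici {d : ℕ} (u v : σ →₀ ℕ) {Z : Finset σ} (h : d ≤ Z.card) :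
    HasBoxPartition (d - 1) (box u Z \ Set.Ici v) := by
  classical
  -- The sum measures how far `u` is from `v` in the free directions. At zero, divisibility by `x^v`
  -- is the same for all points of the box.
  induction hN : ∑ k ∈ Z, (v k - u k) generalizing u with
  | zero =>
    have hZ : ∀ k ∈ Z, v k ≤ u k := fun k hk => by
      have := Finset.sum_eq_zero_iff.1 hN k hk
      omega
    by_cases hvu : v ≤ u
    · have : box u Z \ Set.Ici v = ∅ :=
        Set.sdiff_eq_empty.2 fun c hc => hvu.trans hc.1
      rw [this]
      exact hasBoxPartition_empty _
    · have : box u Z \ Set.Ici v = box u Z := by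
        refine sdiff_eq_left.2 (Set.disjoint_left.2 fun c hc hvc => hvu fun k => ?_)
        by_cases hk : k ∈ Z
        · exact hZ k hk
        · exact hc.2 k hk ▸ hvc k
      rw [this]
      exact hasBoxPartition_box u (by omega)
  | succ N ih =>
    obtain ⟨k, hk, hlt⟩ : ∃ k ∈ Z, 0 < v k - u k := by
      by_contra! hcon
      have : ∑ k ∈ Z, (v k - u k) = 0 :=
        Finset.sum_eq_zero fun k hk => Nat.le_zero.1 (hcon k hk)
      omega
    -- Cut along a direction `k` with `u k < v k`. The slice `c k = u k` misses `Set.Ici v` and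
    -- loses only `k`; the rest is a box that keeps all of `Z`, so the loss does not accumulate
    -- along the induction.
    have key : box u Z \ Set.Ici v =
        box u (Z.erase k) ∪ (box (u + Finsupp.single k 1) Z \ Set.Ici v) := by
      ext c
      simp only [Set.mem_sdiff, Set.mem_union, mem_box_erase_iff, mem_box_add_single_iff hk,
        Set.mem_Ici]
      constructor
      · tauto
      · rintro (⟨h1, h2⟩ | h)
        · refine ⟨h1, fun hvc => ?_⟩
          have := hvc k
          omega
        · tauto
    rw [key]
    refine HasBoxPartition.union ?_ (hasBoxPartition_box u ?_) (ih _ ?_)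
    · refine Set.disjoint_left.2 fun c hc hc' => ?_
      exact ((mem_box_add_single_iff hk).1 hc'.1).2 (mem_box_erase_iff.1 hc).2
    · rw [Finset.card_erase_of_mem hk]
      omega
    · rw [← Finset.add_sum_erase _ _ hk] at hN ⊢
      have : ∑ l ∈ Z.erase k, (v l - (u + Finsupp.single k 1 : σ →₀ ℕ) l) =
          ∑ l ∈ Z.erase k, (v l - u l) :=
        Finset.sum_congr rfl fun l hl => by
          simp [(Finset.ne_of_mem_erase hl).symm]
      rw [this]
      simp
      omega

theorem HasBoxPartition.diff_Ici {d : ℕ} {M : Set (σ →₀ ℕ)} (h : HasBoxPartition d M)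
    (v : σ →₀ ℕ) : HasBoxPartition (d - 1) (M \ Set.Ici v) := by
  obtain ⟨ι, hι, u, Z, h1, h2, rfl⟩ := h
  rw [Set.iUnion_sdiff]
  exact hasBoxPartition_iUnion (fun i j hij => (h2 hij).mono Set.sdiff_subset Set.sdiff_subset)
    fun i => hasBoxPartition_box_diff_Ici _ v (h1 i)

theorem HasBoxPartition.diff_biUnion_Ici {d : ℕ} {M : Set (σ →₀ ℕ)} (h : HasBoxPartition d M)
    {ι : Type*} (v : ι → σ →₀ ℕ) (s : Finset ι) :
    HasBoxPartition (d - s.card) (M \ ⋃ i ∈ s, Set.Ici (v i)) := by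
  classical
  induction s using Finset.induction_on with
  | empty => simpa using h
  | insert a s ha ih =>
    rw [Finset.set_biUnion_insert, Set.union_comm, ← Set.sdiff_sdiff, Finset.card_insert_of_notMem ha,
      ← Nat.sub_sub]
    exact ih.diff_Ici (v a)

/-- The monomials divisible by all `x^(v i)` with `i ∈ A` and by none with `i ∉ B`. -/
theorem hasBoxPartition_between [Fintype σ] {ι : Type*} [Fintype ι] [DecidableEq ι]
    (v : ι → σ →₀ ℕ) (A B : Finset ι) :
    HasBoxPartition (Fintype.card σ - Bᶜ.card)
      {c | (∀ i ∈ A, v i ≤ c) ∧ ∀ i, v i ≤ c → i ∈ B} := by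
  -- `A.sup v` is the exponent of the lcm of the `x^(v i)` with `i ∈ A`.
  have h : HasBoxPartition (Fintype.card σ) (box (A.sup v) Finset.univ) :=
    hasBoxPartition_box _ (by simp)
  convert h.diff_biUnion_Ici v Bᶜ using 1
  ext c
  simp only [box, Set.mem_ofPred_eq, Set.mem_sdiff, Finset.sup_le_iff, Finset.mem_univ,
    not_true_eq_false, false_imp_iff, implies_true, and_true, Set.mem_iUnion, Set.mem_Ici,
    Finset.mem_compl, not_exists, exists_prop, not_and]
  exact and_congr_right fun _ => forall_congr' fun i => by tauto

/-- Lower ends of a partition of the nonempty subsets of a 4-element set into intervals whose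
upper ends have at least two elements. -/
def lowerEnd : Fin 8 → Finset (Fin 4) :=
  ![{0}, {1}, {2}, {3}, {0, 2}, {1, 3}, {0, 2, 3}, {1, 2, 3}]

/-- Upper ends of the intervals in the partition with lower ends `lowerEnd`. -/
def upperEnd : Fin 8 → Finset (Fin 4) :=
  ![{0, 1}, {1, 2}, {2, 3}, {0, 3}, {0, 1, 2}, {0, 1, 3}, {0, 1, 2, 3}, {1, 2, 3}]

/-- This bound on the number of removed orthants is the source of the 2 in `n - 2`. -/
theorem card_compl_upperEnd_le : ∀ j, (upperEnd j)ᶜ.card ≤ 2 := by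
  decide

theorem lowerEnd_nonempty : ∀ j, (lowerEnd j).Nonempty := by
  decide

theorem exists_interval : ∀ T : Finset (Fin 4), T.Nonempty →
    ∃ j, lowerEnd j ⊆ T ∧ T ⊆ upperEnd j := by
  decide

theorem interval_unique : ∀ T : Finset (Fin 4), ∀ i j, lowerEnd i ⊆ T ∧ T ⊆ upperEnd i →
    lowerEnd j ⊆ T ∧ T ⊆ upperEnd j → i = j := by
  decide

theorem hasBoxPartition_iUnion_Ici [Fintype σ] (v : Fin 4 → σ →₀ ℕ) :
    HasBoxPartition (Fintype.card σ - 2) (⋃ i, Set.Ici (v i)) := by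
  classical
  let T : (σ →₀ ℕ) → Finset (Fin 4) := fun c => {i | v i ≤ c}
  let M : Fin 8 → Set (σ →₀ ℕ) := fun j =>
    {c | (∀ i ∈ lowerEnd j, v i ≤ c) ∧ ∀ i, v i ≤ c → i ∈ upperEnd j}
  have hM : ∀ c j, c ∈ M j ↔ lowerEnd j ⊆ T c ∧ T c ⊆ upperEnd j := fun c j => by
    simp [M, T, Finset.subset_iff]
  have hU : ⋃ i, Set.Ici (v i) = ⋃ j, M j := by
    ext c
    have hT : c ∈ ⋃ i, Set.Ici (v i) ↔ (T c).Nonempty := by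
      simp [T, Finset.Nonempty]
    rw [hT, Set.mem_iUnion]
    simp only [hM]
    exact ⟨exists_interval _, fun ⟨j, hj, _⟩ => (lowerEnd_nonempty j).mono hj⟩
  rw [hU]
  refine hasBoxPartition_iUnion (fun i j hij => Set.disjoint_left.2 fun c hi hj =>
    hij (interval_unique (T c) i j ((hM c i).1 hi) ((hM c j).1 hj))) fun j => ?_
  exact (hasBoxPartition_between v _ _).mono (Nat.sub_le_sub_left (card_compl_upperEnd_le j) _)

end Box

/-! ### From box partitions to Stanley decompositions -/

section Decomposition

variable {K : Type*} [Field K] {n : ℕ}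

theorem stanleySpace_monomial (u : Fin n →₀ ℕ) (Z : Finset (Fin n)) :
    stanleySpace (monomial u (1 : K)) Z = restrictSupport K (box u Z) := by
  classical
  apply le_antisymm
  · rintro _ ⟨p, hp, rfl⟩
    have hp' : (p.vars : Set (Fin n)) ⊆ Z := mem_supported.1 hp
    rw [mem_restrictSupport_iff]
    intro c hc
    rw [Finset.mem_coe, mem_support_iff, LinearMap.mulLeft_apply, coeff_monomial_mul'] at hc
    by_cases huc : u ≤ c
    · rw [if_pos huc, one_mul, ← mem_support_iff] at hc
      refine ⟨huc, fun k hk => ?_⟩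
      have h0 : (c - u) k = 0 := by
        by_contra hne
        exact hk (hp' (mem_vars_iff_mem_support k |>.2 ⟨_, hc, Finsupp.mem_support_iff.2 hne⟩))
      have := huc k
      rw [Finsupp.tsub_apply] at h0
      omega
    · exact (hc (if_neg huc)).elim
  · rw [restrictSupport_eq_span, Submodule.span_le]
    rintro _ ⟨c, hc, rfl⟩
    refine ⟨monomial (c - u) 1, ?_, ?_⟩
    · change _ ∈ supported K (Z : Set (Fin n))
      rw [mem_supported, vars_monomial one_ne_zero]
      intro k hk
      by_contra hkZ
      refine Finsupp.mem_support_iff.1 hk ?_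
      rw [Finsupp.tsub_apply, hc.2 k hkZ, Nat.sub_self]
    · simp [monomial_mul, add_tsub_cancel_of_le hc.1]

theorem iSup_restrictSupport {ι : Sort*} (s : ι → Set (Fin n →₀ ℕ)) :
    ⨆ i, restrictSupport K (s i) = restrictSupport K (⋃ i, s i) := by
  simp only [restrictSupport_eq_span, Set.image_iUnion, Submodule.span_iUnion]

theorem disjoint_restrictSupport {s t : Set (Fin n →₀ ℕ)} (h : Disjoint s t) :
    Disjoint (restrictSupport K s) (restrictSupport K t) := by
  rw [Submodule.disjoint_def]
  intro p hs ht
  rw [← support_eq_empty, ← Finset.coe_eq_empty]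
  exact Set.subset_empty_iff.1 (h hs ht)

theorem iSupIndep_restrictSupport {ι : Type*} {s : ι → Set (Fin n →₀ ℕ)}
    (h : Pairwise (fun i j => Disjoint (s i) (s j))) :
    iSupIndep fun i => restrictSupport K (s i) := by
  intro i
  simp only [iSup_restrictSupport]
  refine disjoint_restrictSupport ?_
  simp only [Set.disjoint_iUnion_right]
  exact fun j hj => h hj.symm

/-- A box partition of the set of exponents of `I` gives a Stanley decomposition. -/
theorem exists_stanleyDecomposition {I : Ideal (MvPolynomial (Fin n) K)} {M : Set (Fin n →₀ ℕ)}
    (hIM : Submodule.restrictScalars K I = restrictSupport K M) {d : ℕ}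
    (h : HasBoxPartition d M) :
    ∃ D : StanleyDecomposition I, ∀ i, d ≤ (D.vars i).card := by
  obtain ⟨ι, hι, u, Z, h1, h2, rfl⟩ := h
  let e := (Finite.equivFin ι).symm
  refine ⟨⟨Nat.card ι, fun i => monomial (u (e i)) 1, fun i => Z (e i), fun i => ?_,
    fun i => ?_, fun i => ⟨_, _, rfl⟩, ?_, ?_⟩, fun i => h1 (e i)⟩
  · have : monomial (u (e i)) (1 : K) ∈ Submodule.restrictScalars K I := by
      rw [hIM, monomial_mem_restrictSupport]
      exact Or.inl (Set.mem_iUnion.2 ⟨e i, self_mem_box _ _⟩)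
    exact this
  · simp
  · simp only [stanleySpace_monomial]
    exact iSupIndep_restrictSupport fun i j hij => h2 (e.injective.ne hij)
  · simp only [stanleySpace_monomial]
    rw [iSup_restrictSupport, hIM]
    congr 1
    exact e.surjective.iUnion_comp fun i => box (u i) (Z i)

theorem StanleyDecomposition.sdepth_le {I : Ideal (MvPolynomial (Fin n) K)}
    (D : StanleyDecomposition I) : D.sdepth ≤ n := by
  unfold StanleyDecomposition.sdepth
  rcases isEmpty_or_nonempty (Fin D.len) with h | ⟨⟨i⟩⟩
  · simp
  · exact (ciInf_le (OrderBot.bddBelow _) i).trans ((Finset.card_le_univ _).trans (by simp))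

/-- An infimum over no summands is 0 in `ℕ`; a nonzero ideal excludes that case. -/
theorem StanleyDecomposition.le_sdepth {I : Ideal (MvPolynomial (Fin n) K)} (hI : I ≠ ⊥)
    (D : StanleyDecomposition I) {d : ℕ} (h : ∀ i, d ≤ (D.vars i).card) : d ≤ D.sdepth := by
  rcases isEmpty_or_nonempty (Fin D.len) with h0 | h0
  · refine (hI ?_).elim
    have := D.iSup_eq
    rw [iSup_of_empty] at this
    exact (Submodule.restrictScalars_eq_bot_iff K _ _).1 this.symm
  · exact le_ciInf h

end Decomposition

/-! ### Monomial ideals generated by few elements -/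

section Generators

variable {K : Type*} [Field K] {n : ℕ}

/-- By minimality of `g`, the only exponent of `p` that can contribute to `g` is `g` itself. Hence
coefficients at minimal exponents see `q` only through its constant term. -/
theorem coeff_mul_of_minimal {I : Ideal (MvPolynomial (Fin n) K)} {M : Set (Fin n →₀ ℕ)}
    (hIM : Submodule.restrictScalars K I = restrictSupport K M) {g : Fin n →₀ ℕ}
    (hg : Minimal (· ∈ M) g) {p : MvPolynomial (Fin n) K} (hp : p ∈ I)
    (q : MvPolynomial (Fin n) K) : coeff g (q * p) = coeff 0 q * coeff g p := by
  classical
  have hpM : ↑p.support ⊆ M := (mem_restrictSupport_iff K).1 (hIM ▸ hp)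
  rw [coeff_mul, Finset.sum_eq_single (0, g)]
  · rintro ⟨a, b⟩ hab hne
    rw [Finset.HasAntidiagonal.mem_antidiagonal] at hab
    by_cases hb : b ∈ p.support
    · have hbg : b = g := hg.eq_of_le (hpM hb) (hab ▸ le_add_self)
      subst hbg
      exact (hne (by simpa using hab)).elim
    · rw [notMem_support_iff.1 hb, mul_zero]
  · simp

/-- The number of minimal monomials of a monomial ideal is at most the number of elements in any
generating family. -/
theorem card_le_of_minimal {I : Ideal (MvPolynomial (Fin n) K)} {M : Set (Fin n →₀ ℕ)}
    (hIM : Submodule.restrictScalars K I = restrictSupport K M) {m : ℕ}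
    (f : Fin m → MvPolynomial (Fin n) K) (hf : I = Ideal.span (Set.range f))
    (G : Finset (Fin n →₀ ℕ)) (hG : ∀ g ∈ G, Minimal (· ∈ M) g) : G.card ≤ m := by
  classical
  -- `φ` plays the role of reduction modulo the maximal ideal `(x_1, …, x_n)`: it sends `I` onto `G
  -- → K`, and the images of the `f i` already span `φ(I)` over `K`.
  let φ : MvPolynomial (Fin n) K →ₗ[K] (G → K) := LinearMap.pi fun g => lcoeff K g.1
  have hφ : ∀ p g, φ p g = coeff g.1 p := fun p g => rfl
  have hI : ∀ p ∈ I, φ p ∈ Submodule.span K (Set.range (φ ∘ f)) := by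
    intro p hp
    rw [hf] at hp
    induction hp using Submodule.span_induction with
    | mem x hx =>
      obtain ⟨i, rfl⟩ := hx
      exact Submodule.subset_span ⟨i, rfl⟩
    | zero => simp
    | add x y _ _ hx hy => rw [map_add]; exact add_mem hx hy
    | smul q x hx ih =>
      have : φ (q • x) = coeff 0 q • φ x := by
        ext g
        rw [smul_eq_mul, hφ, coeff_mul_of_minimal hIM (hG g.1 g.2) (hf ▸ hx)]
        rfl
      rw [this]
      exact Submodule.smul_mem _ _ ih
  have htop : Submodule.span K (Set.range (φ ∘ f)) = ⊤ := by
    rw [eq_top_iff, ← (Pi.basisFun K G).span_eq, Submodule.span_le]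
    rintro _ ⟨g, rfl⟩
    have hg : monomial g.1 (1 : K) ∈ Submodule.restrictScalars K I := by
      rw [hIM, monomial_mem_restrictSupport]
      exact Or.inl (hG g.1 g.2).prop
    have hφg : Pi.basisFun K G g = φ (monomial g.1 1) := by
      ext g'
      rw [hφ, coeff_monomial, Pi.basisFun_apply, Pi.single_apply]
      simp only [Subtype.ext_iff, eq_comm]
    rw [hφg]
    exact hI _ hg
  have := finrank_range_le_card (R := K) (φ ∘ f)
  rw [Set.finrank, htop, finrank_top] at this
  simpa using this

theorem exists_iUnion_Ici {I : Ideal (MvPolynomial (Fin n) K)} {M : Set (Fin n →₀ ℕ)}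
    (hIM : Submodule.restrictScalars K I = restrictSupport K M) (hM : IsUpperSet M)
    (hM0 : M.Nonempty) {m : ℕ} (f : Fin m → MvPolynomial (Fin n) K)
    (hf : I = Ideal.span (Set.range f)) :
    ∃ v : Fin m → Fin n →₀ ℕ, M = ⋃ i, Set.Ici (v i) := by
  classical
  let G : Set (Fin n →₀ ℕ) := {g | Minimal (· ∈ M) g}
  have hGfin : G.Finite := by
    by_contra hinf
    obtain ⟨t, ht, hcard⟩ := Set.Infinite.exists_subset_card_eq hinf (m + 1)
    have := card_le_of_minimal hIM f hf t fun g hg => ht hg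
    omega
  have hGcard : hGfin.toFinset.card ≤ m :=
    card_le_of_minimal hIM f hf _ fun g hg => hGfin.mem_toFinset.1 hg
  have hle : ∀ c ∈ M, ∃ g ∈ G, g ≤ c := fun c hc => by
    obtain ⟨g, hgc, hg⟩ := exists_minimal_le_of_wellFoundedLT (· ∈ M) c hc
    exact ⟨g, hg, hgc⟩
  obtain ⟨c, hc⟩ := hM0
  obtain ⟨g₀, hg₀, -⟩ := hle c hc
  let e := hGfin.toFinset.equivFin
  -- There may be fewer than `m` minimal exponents; the remaining indices repeat `g₀`, which leaves
  -- the union unchanged.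
  let v : Fin m → Fin n →₀ ℕ := fun i =>
    if h : i.1 < hGfin.toFinset.card then (e.symm ⟨i.1, h⟩).1 else g₀
  refine ⟨v, Set.Subset.antisymm (fun c hc => ?_) (Set.iUnion_subset fun i c hc => ?_)⟩
  · obtain ⟨g, hg, hgc⟩ := hle c hc
    let j := e ⟨g, hGfin.mem_toFinset.2 hg⟩
    refine Set.mem_iUnion.2 ⟨⟨j.1, j.2.trans_le hGcard⟩, ?_⟩
    simpa [v, j] using hgc
  · have hv : v i ∈ G := by
      simp only [v]
      split_ifs with h
      · exact hGfin.mem_toFinset.1 (e.symm ⟨i.1, h⟩).2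
      · exact hg₀
    exact hM hc hv.prop

theorem IsSquarefreeMonomialIdeal.exists_restrictSupport {I : Ideal (MvPolynomial (Fin n) K)}
    (hI : IsSquarefreeMonomialIdeal I) :
    ∃ M : Set (Fin n →₀ ℕ), IsUpperSet M ∧
      Submodule.restrictScalars K I = restrictSupport K M := by
  obtain ⟨A, -, rfl⟩ := hI
  refine ⟨{c | ∃ a ∈ A, a ≤ c}, fun c d hcd ⟨a, ha, hac⟩ => ⟨a, ha, hac.trans hcd⟩, ?_⟩
  ext p
  rw [Submodule.restrictScalars_mem, mem_ideal_span_monomial_image, mem_restrictSupport_iff]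
  rfl

end Generators

end StanleyDepth

theorem mainTheorem3 {K : Type*} [Field K] {n : ℕ} (I : Ideal (MvPolynomial (Fin n) K))
    (hI : StanleyDepth.IsSquarefreeMonomialIdeal I) (hI0 : I ≠ ⊥)
    (hgen : ∃ f : Fin 4 → MvPolynomial (Fin n) K, I = Ideal.span (Set.range f)) :
    IsGreatest (StanleyDepth.sdepthSet I) (StanleyDepth.sdepth I) ∧
      (n : ℤ) - 2 ≤ (StanleyDepth.sdepth I : ℤ) := by
  obtain ⟨f, hf⟩ := hgen
  obtain ⟨M, hM, hIM⟩ := hI.exists_restrictSupport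
  have hM0 : M.Nonempty := by
    rw [Set.nonempty_iff_ne_empty]
    rintro rfl
    refine hI0 ((Submodule.restrictScalars_eq_bot_iff K _ _).1 ?_)
    rw [hIM, restrictSupport_eq_span, Set.image_empty, Submodule.span_empty]
  obtain ⟨v, rfl⟩ := StanleyDepth.exists_iUnion_Ici hIM hM hM0 f hf
  obtain ⟨D, hD⟩ := StanleyDepth.exists_stanleyDecomposition hIM
    (StanleyDepth.hasBoxPartition_iUnion_Ici v)
  have hbdd : BddAbove (StanleyDepth.sdepthSet I) :=
    ⟨n, by rintro _ ⟨D, rfl⟩; exact D.sdepth_le⟩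
  have hmem : D.sdepth ∈ StanleyDepth.sdepthSet I := ⟨D, rfl⟩
  refine ⟨⟨Nat.sSup_mem ⟨_, hmem⟩ hbdd, fun d hd => le_csSup hbdd hd⟩, ?_⟩
  have h1 : n - 2 ≤ D.sdepth := by simpa using D.le_sdepth hI0 hD
  have h2 : D.sdepth ≤ StanleyDepth.sdepth I := le_csSup hbdd hmem
  omega
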